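/- Let $\alpha$ be an infinite set. A transformation $\tau:\alpha\to\alpha$ is *finite* if $\{i\in\alpha:\tau(i)\neq i\}$ is finite. A *quasi-polyadic equality algebra of dimension $\alpha$* is an algebra $\langle A,+,-,c_{(\Gamma)},s_\tau,d_{ij}\rangle$, with a unary operation $c_{(\Gamma)}$ for each finite $\Gamma\subseteq\alpha$, a unary operation $s_\tau$ for each finite transformation $\tau$ of $\alpha$, and a constant $d_{ij}$ for all $i,j\in\alpha$, such that $\langle A,+,-\rangle$ is a Boolean algebra and, for all $x,y\in A$, finite $\Gamma,\Delta\subseteq\alpha$, finite transformations $\sigma,\tau$ and $i,j\in\alpha$: - $c_{(\Gamma)}0=0$, $\;x\le c_{(\Gamma)}x$, $\;c_{(\Gamma)}(x\cdot c_{(\Gamma)}y)=c_{(\Gamma)}x\cdot c_{(\Gamma)}y$, $\;c_{(\emptyset)}x=x$, $\;c_{(\Gamma)}c_{(\Delta)}x=c_{(\Gamma\cup\Delta)}x$; - $s_{\mathrm{id}}x=x$, $\;s_{\sigma\circ\tau}x=s_\sigma s_\tau x$, $\;s_\tau(x+y)=s_\tau x+s_\tau y$, $\;s_\tau(-x)=-s_\tau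 x$; - if $\sigma$ and $\tau$ agree on $\alpha\setminus\Gamma$, then $s_\sigma c_{(\Gamma)}x=s_\tau c_{(\Gamma)}x$; if $\tau^{-1}[\Gamma]=\Delta$ and $\tau$ is one-to-one on $\Delta$, then $c_{(\Gamma)}s_\tau x=s_\tau c_{(\Delta)}x$; - $d_{ii}=1$, $\;x\cdot d_{ij}\le s_{[i/j]}x$, where $[i/j]$ sends $i$ to $j$ and fixes everything else, and $s_\tau d_{ij}=d_{\tau(i)\tau(j)}$. Let $\mathsf{QPEA}_\alpha$ be the class of all these algebras. A *subvariety* of $\mathsf{QPEA}_\alpha$ is a class consisting of all members of $\mathsf{QPEA}_\alpha$ in which every equation of some set of equations (between terms in countably many variables) is valid. For a permutation $\rho$ of $\alpha$ and an equation $e$, let $\rho(e)$ be the equation obtained from $e$ by renaming all indices along $\rho$: each $c_{(\Gamma)}$ is replaced by $c_{(\rho[\Gamma])}$, each $s_\tau$ by $s_{\rho\circ\tau\circ\rho^{-1}}$, and each $d_{ij}$ by $d_{\rho(i)\rho(j)}$. **Theorem.** $\mathsf{QPEA}_\alpha$ has exactly $2^{\omega}$ subvarieties. Moreover every $\mathfrak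 A\in\mathsf{QPEA}_\alpha$ is symmetric: for every equation $e$ and every permutation $\rho$ of $\alpha$, $\mathfrak A\models e$ if and only if $\mathfrak A\models\rho(e)$. -/

import Mathlib

universe u v w

namespace QuasiPolyadic

/-- Finite transformations of `α`: maps `α → α` that move only finitely many elements. -/
def FinTrans (α : Type u) : Type u := {τ : α → α // {i | τ i ≠ i}.Finite}

namespace FinTrans

instance (α : Type u) : CoeFun (FinTrans α) (fun _ => α → α) := ⟨fun τ => τ.1⟩

/-- The identity transformation. -/
def one (α : Type u) : FinTrans α := ⟨id, by simp⟩

/-- Composition: `(comp σ τ) i = σ (τ i)`. -/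
def comp {α : Type u} (σ τ : FinTrans α) : FinTrans α :=
  ⟨fun i => σ.1 (τ.1 i), by
    refine (σ.2.union τ.2).subset ?_
    intro i hi
    by_cases h : τ.1 i = i
    · left
      simpa [h] using hi
    · right
      exact h⟩

open Classical in
/-- The replacement `[i/j]`: it sends `i` to `j` and fixes every other element. -/
noncomputable def repl {α : Type u} (i j : α) : FinTrans α :=
  ⟨Function.update id i j, by
    refine (Set.finite_singleton i).subset ?_
    intro k hk
    by_contra h
    exact hk (Function.update_of_ne h j id)⟩

/-- Renaming of indices in a finite transformation: `τ` becomes `ρ ∘ τ ∘ ρ⁻¹`. -/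
def conj {α : Type u} (ρ : Equiv.Perm α) (τ : FinTrans α) : FinTrans α :=
  ⟨fun i => ρ (τ.1 (ρ.symm i)), by
    refine (τ.2.image ρ).subset ?_
    intro i hi
    refine ⟨ρ.symm i, ?_, by simp⟩
    intro h
    exact hi (by simp [h])⟩

end FinTrans

open Classical in
/-- A quasi-polyadic equality algebra of dimension `α`, with universe in `Type w`: a Boolean algebra
with generalized cylindrifications `c_(Γ)` for finite `Γ ⊆ α`, substitutions `s_τ` for finite
transformations `τ` of `α`, and diagonal constants `d_ij`. These are Halmos' axioms for polyadic
equality algebras, restricted to finite `Γ` and finite `τ`. -/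
structure QPEA (α : Type u) where
  /-- the universe of the algebra -/
  carrier : Type w
  [bool : BooleanAlgebra carrier]
  /-- the cylindrification `c_(Γ)` -/
  c : Finset α → carrier → carrier
  /-- the substitution `s_τ` -/
  s : FinTrans α → carrier → carrier
  /-- the diagonal constant `d_ij` -/
  d : α → α → carrier
  c_bot : ∀ Γ, c Γ ⊥ = ⊥
  le_c : ∀ Γ x, x ≤ c Γ x
  c_inf_c : ∀ Γ x y, c Γ (x ⊓ c Γ y) = c Γ x ⊓ c Γ y
  c_empty : ∀ x, c ∅ x = x
  c_c : ∀ Γ Δ x, c Γ (c Δ x) = c (Γ ∪ Δ) x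
  s_one : ∀ x, s (FinTrans.one α) x = x
  s_comp : ∀ σ τ x, s (FinTrans.comp σ τ) x = s σ (s τ x)
  s_sup : ∀ τ x y, s τ (x ⊔ y) = s τ x ⊔ s τ y
  s_compl : ∀ τ x, s τ xᶜ = (s τ x)ᶜ
  s_c_congr : ∀ (Γ : Finset α) (σ τ : FinTrans α) x, (∀ i, i ∉ Γ → σ i = τ i) →
    s σ (c Γ x) = s τ (c Γ x)
  c_s : ∀ (Γ Δ : Finset α) (τ : FinTrans α) x, (τ : α → α) ⁻¹' (Γ : Set α) = (Δ : Set α) →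
    Set.InjOn (τ : α → α) (Δ : Set α) → c Γ (s τ x) = s τ (c Δ x)
  d_self : ∀ i, d i i = ⊤
  inf_d_le : ∀ i j x, x ⊓ d i j ≤ s (FinTrans.repl i j) x
  s_d : ∀ (τ : FinTrans α) i j, s τ (d i j) = d (τ i) (τ j)

attribute [instance] QPEA.bool

/-- Terms in the language of `α`-dimensional quasi-polyadic equality algebras, over a countable set
of algebraic variables. The other Boolean operations are defined from join and complement. -/
inductive Term (α : Type u) : Type u where
  | var : ℕ → Term α
  | sup : Term α → Term α → Term α
  | compl : Term α → Term α
  | cyl : Finset α → Term α → Term α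
  | subst : FinTrans α → Term α → Term α
  | diag : α → α → Term α

namespace Term

/-- The value of a term in the algebra `A` under an evaluation of the variables. -/
def eval {α : Type u} (A : QPEA.{u, w} α) (f : ℕ → A.carrier) : Term α → A.carrier
  | var n => f n
  | sup t r => eval A f t ⊔ eval A f r
  | compl t => (eval A f t)ᶜ
  | cyl Γ t => A.c Γ (eval A f t)
  | subst τ t => A.s τ (eval A f t)
  | diag i j => A.d i j

/-- `ρ(t)`: every index occurring in `t` is systematically replaced by its image under the
permutation `ρ`; that is, `c_(Γ)`, `s_τ`, `d_ij` become `c_(ρ[Γ])`, `s_(ρ ∘ τ ∘ ρ⁻¹)`,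
`d_(ρi)(ρj)`. In particular the transposition `[i,j]` becomes `[ρi,ρj]` and the replacement `[i/j]`
becomes `[ρi/ρj]`. -/
def rename {α : Type u} (ρ : Equiv.Perm α) : Term α → Term α
  | var n => var n
  | sup t r => sup (rename ρ t) (rename ρ r)
  | compl t => compl (rename ρ t)
  | cyl Γ t => cyl (Γ.map ρ.toEmbedding) (rename ρ t)
  | subst τ t => subst (FinTrans.conj ρ τ) (rename ρ t)
  | diag i j => diag (ρ i) (ρ j)

end Term

/-- Equations `lhs = rhs` between terms. -/
structure Equation (α : Type u) where
  lhs : Term α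
  rhs : Term α

/-- `ρ(e)`, the equation `e` with its indices renamed along `ρ`. -/
def Equation.rename {α : Type u} (ρ : Equiv.Perm α) (e : Equation α) : Equation α :=
  ⟨e.lhs.rename ρ, e.rhs.rename ρ⟩

/-- The equation `e` is valid in the algebra `A`. -/
def QPEA.Models {α : Type u} (A : QPEA.{u, w} α) (e : Equation α) : Prop :=
  ∀ f : ℕ → A.carrier, e.lhs.eval A f = e.rhs.eval A f

/-- `A` is symmetric: the set of equations valid in `A` is invariant under renaming of indices by
arbitrary permutations of `α`. -/
def QPEA.IsSymmetric {α : Type u} (A : QPEA.{u, w} α) : Prop :=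
  ∀ (ρ : Equiv.Perm α) (e : Equation α), A.Models e ↔ A.Models (e.rename ρ)

/-- A class of `α`-dimensional quasi-polyadic equality algebras is a subvariety of the class of all
of them if it consists of all those in which some set of equations is valid. -/
def IsSubvariety {α : Type u} (V : Set (QPEA.{u, w} α)) : Prop :=
  ∃ E : Set (Equation α), V = {A | ∀ e ∈ E, A.Models e}

end QuasiPolyadic

namespace QuasiPolyadic

/-! ### Finite permutations -/

/-! Symmetry: an equation mentions finitely many indices, so renaming along `ρ` agrees with renaming
along some permutation `π` of finite support. Then `s_π` is an operation of the algebra; it is a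
Boolean automorphism that carries each basic operation to its renaming along `π`, hence preserves
validity (`QPEA.s_eval_of_perm`).

Upper bound: by symmetry, each equation is equivalent, in every algebra, to one whose indices lie in
a fixed countably infinite set. There are countably many of those, whatever the size of `α`, and
they determine the subvariety (`IsSubvariety.eq_models`).

Lower bound: for each `n`, an equation holds in a set algebra with finite nonempty base exactly when
the base does not have `n` elements (`setAlgebra_models_sizeNe`). Forbidding arbitrary sets of sizes
gives continuum many subvarieties. -/

/-- An injection on a finite set extends to a permutation that moves only finitely many points. -/
theorem exists_finite_perm_extending {α : Type u} {S : Set α} (hS : S.Finite) (f : α → α)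
    (hf : S.InjOn f) : ∃ π : Equiv.Perm α, {i | π i ≠ i}.Finite ∧ ∀ i ∈ S, π i = f i := by
  classical
  induction S, hS using Set.Finite.induction_on with
  | empty => exact ⟨1, by simp, by simp⟩
  | @insert a S ha _ ih =>
    obtain ⟨π, hπ, h⟩ := ih (hf.mono (Set.subset_insert a S))
    -- The outer swap corrects the value at `a`; by injectivity of `π` and `f`, neither swapped
    -- point is a value on `S`.
    refine ⟨Equiv.swap (π a) (f a) * π, ?_, ?_⟩
    · refine (hπ.union (Set.toFinite {a, f a, π.symm (f a)})).subset ?_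
      intro i hi
      by_contra hn
      simp only [Set.mem_union, Set.mem_ofPred_eq, Set.mem_insert_iff, Set.mem_singleton_iff,
        not_or, not_not] at hn
      obtain ⟨h1, h2, h3, -⟩ := hn
      refine hi ?_
      rw [Equiv.Perm.mul_apply, h1, Equiv.swap_apply_of_ne_of_ne _ h3]
      intro h4
      exact h2 (π.injective (h1.trans h4))
    · rintro i (rfl | hi)
      · simp
      · have hia : i ≠ a := fun h => ha (h ▸ hi)
        rw [Equiv.Perm.mul_apply, Equiv.swap_apply_of_ne_of_ne, h i hi]
        · exact fun h => hia (π.injective h)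
        · rw [h i hi]
          exact fun h => hia (hf (Set.mem_insert_of_mem a hi) (Set.mem_insert a S) h)

/-! ### The indices occurring in a term -/

/-- The points moved by `τ` together with their images. -/
def FinTrans.indices {α : Type u} (τ : FinTrans α) : Set α :=
  {i | τ i ≠ i} ∪ (τ : α → α) '' {i | τ i ≠ i}

theorem FinTrans.conj_congr {α : Type u} {ρ π : Equiv.Perm α} {τ : FinTrans α}
    (h : ∀ i ∈ τ.indices, ρ i = π i) : conj ρ τ = conj π τ := by
  apply Subtype.ext
  funext k
  change ρ (τ (ρ.symm k)) = π (τ (π.symm k))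
  by_cases hi : τ (ρ.symm k) = ρ.symm k
  · by_cases hj : τ (π.symm k) = π.symm k
    · simp [hi, hj]
    -- A preimage of `k` moved by `τ` is an index where `ρ` and `π` agree, so both preimages of `k`
    -- coincide.
    · have h1 := h _ (Or.inl hj)
      rw [Equiv.apply_symm_apply, ← Equiv.eq_symm_apply] at h1
      exact absurd (h1 ▸ hi) hj
  · have h1 := h _ (Or.inl hi)
    rw [Equiv.apply_symm_apply, eq_comm, ← Equiv.eq_symm_apply] at h1
    rw [← h1]
    exact h _ (Or.inr ⟨_, hi, rfl⟩)

theorem FinTrans.indices_conj_subset {α : Type u} (ρ : Equiv.Perm α) (τ : FinTrans α) :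
    (conj ρ τ).indices ⊆ ρ '' τ.indices := by
  have key : ∀ k, conj ρ τ k ≠ k → τ (ρ.symm k) ≠ ρ.symm k := by
    intro k hk h
    apply hk
    change ρ (τ (ρ.symm k)) = k
    rw [h, Equiv.apply_symm_apply]
  rintro k (hk | ⟨j, hj, rfl⟩)
  · exact ⟨_, Or.inl (key k hk), by simp⟩
  · exact ⟨_, Or.inr ⟨_, key j hj, rfl⟩, rfl⟩

namespace Term

/-- The indices occurring in a term. -/
def indices {α : Type u} : Term α → Set α
  | var _ => ∅
  | sup t r => t.indices ∪ r.indices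
  | compl t => t.indices
  | cyl Γ t => ↑Γ ∪ t.indices
  | subst τ t => τ.indices ∪ t.indices
  | diag i j => {i, j}

theorem finite_indices {α : Type u} (t : Term α) : t.indices.Finite := by
  induction t with
  | var _ => exact Set.finite_empty
  | sup t r iht ihr => exact iht.union ihr
  | compl t ih => exact ih
  | cyl Γ t ih => exact Γ.finite_toSet.union ih
  | subst τ t ih => exact (τ.2.union (τ.2.image _)).union ih
  | diag i j => exact Set.toFinite {i, j}

theorem rename_congr {α : Type u} {ρ π : Equiv.Perm α} (t : Term α)
    (h : ∀ i ∈ t.indices, ρ i = π i) : t.rename ρ = t.rename π := by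
  induction t with
  | var _ => rfl
  | sup t r iht ihr =>
    simp only [rename]
    rw [iht fun i hi => h i (Or.inl hi), ihr fun i hi => h i (Or.inr hi)]
  | compl t ih =>
    simp only [rename]
    rw [ih h]
  | cyl Γ t ih =>
    simp only [rename]
    rw [ih fun i hi => h i (Or.inr hi)]
    congr 1
    ext k
    simp only [Finset.mem_map, Equiv.coe_toEmbedding]
    refine exists_congr fun i => and_congr_right fun hi => ?_
    rw [h i (Or.inl hi)]
  | subst τ t ih =>
    simp only [rename]
    rw [ih fun i hi => h i (Or.inr hi), FinTrans.conj_congr fun i hi => h i (Or.inl hi)]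
  | diag i j =>
    simp only [rename]
    rw [h i (by simp [indices]), h j (by simp [indices])]

theorem indices_rename_subset {α : Type u} (ρ : Equiv.Perm α) (t : Term α) :
    (t.rename ρ).indices ⊆ ρ '' t.indices := by
  induction t with
  | var _ => simp [rename, indices]
  | sup t r iht ihr =>
    simp only [rename, indices, Set.image_union]
    exact Set.union_subset_union iht ihr
  | compl t ih => exact ih
  | cyl Γ t ih =>
    simp only [rename, indices, Set.image_union, Finset.coe_map, Equiv.coe_toEmbedding]
    exact Set.union_subset_union subset_rfl ih
  | subst τ t ih =>
    simp only [rename, indices, Set.image_union]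
    exact Set.union_subset_union (FinTrans.indices_conj_subset ρ τ) ih
  | diag i j => simp [rename, indices, Set.image_pair]

theorem rename_symm_rename {α : Type u} (ρ : Equiv.Perm α) (t : Term α) :
    (t.rename ρ).rename ρ.symm = t := by
  induction t with
  | var _ => rfl
  | sup t r iht ihr => simp only [rename, iht, ihr]
  | compl t ih => simp only [rename, ih]
  | cyl Γ t ih =>
    simp only [rename, ih]
    congr 1
    ext k
    simp
  | subst τ t ih =>
    simp only [rename, ih]
    congr 1
    apply Subtype.ext
    funext k
    simp [FinTrans.conj]
  | diag i j => simp [rename]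

end Term

/-- The indices occurring in an equation. -/
def Equation.indices {α : Type u} (e : Equation α) : Set α := e.lhs.indices ∪ e.rhs.indices

theorem Equation.finite_indices {α : Type u} (e : Equation α) : e.indices.Finite :=
  e.lhs.finite_indices.union e.rhs.finite_indices

theorem Equation.indices_rename_subset {α : Type u} (ρ : Equiv.Perm α) (e : Equation α) :
    (e.rename ρ).indices ⊆ ρ '' e.indices := by
  rw [indices, indices, Set.image_union]
  exact Set.union_subset_union (e.lhs.indices_rename_subset ρ) (e.rhs.indices_rename_subset ρ)

/-! ### Symmetry -/

/-- A permutation with finite support, as a finite transformation. -/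
def FinTrans.ofPerm {α : Type u} (π : Equiv.Perm α) (h : {i | π i ≠ i}.Finite) : FinTrans α :=
  ⟨π, h⟩

theorem QPEA.s_c_of_perm {α : Type u} (A : QPEA.{u, w} α) (π : Equiv.Perm α)
    (h : {i | π i ≠ i}.Finite) (Γ : Finset α) (x : A.carrier) :
    A.s (.ofPerm π h) (A.c Γ x) = A.c (Γ.map π.toEmbedding) (A.s (.ofPerm π h) x) := by
  symm
  apply A.c_s
  · change π ⁻¹' _ = _
    simp [Set.preimage_image_eq _ π.injective]
  · exact π.injective.injOn

/-- Each basic operation commutes with `s_π` up to renaming; for `subst` this is `π ∘ τ = (π ∘ τ ∘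
π⁻¹) ∘ π`. -/
theorem QPEA.s_eval_of_perm {α : Type u} (A : QPEA.{u, w} α) (π : Equiv.Perm α)
    (h : {i | π i ≠ i}.Finite) (f : ℕ → A.carrier) (t : Term α) :
    A.s (.ofPerm π h) (t.eval A f) = (t.rename π).eval A fun n => A.s (.ofPerm π h) (f n) := by
  induction t with
  | var _ => rfl
  | sup t r iht ihr => simp only [Term.rename, Term.eval, A.s_sup, iht, ihr]
  | compl t ih => simp only [Term.rename, Term.eval, A.s_compl, ih]
  | cyl Γ t ih => simp only [Term.rename, Term.eval, A.s_c_of_perm, ih]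
  | subst τ t ih =>
    simp only [Term.rename, Term.eval]
    rw [← ih, ← A.s_comp, ← A.s_comp]
    congr 1
    apply Subtype.ext
    funext k
    simp [FinTrans.comp, FinTrans.conj, FinTrans.ofPerm]
  | diag i j => simp only [Term.rename, Term.eval, A.s_d]; rfl

theorem QPEA.Models.rename_of_finite {α : Type u} {A : QPEA.{u, w} α} {e : Equation α}
    (he : A.Models e) (π : Equiv.Perm α) (h : {i | π i ≠ i}.Finite) :
    A.Models (e.rename π) := by
  intro f
  have h' : {i | π.symm i ≠ i}.Finite := by
    refine h.subset fun i hi hi' => hi ?_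
    rw [Equiv.symm_apply_eq]
    exact hi'.symm
  have hinv : ∀ x, A.s (.ofPerm π h) (A.s (.ofPerm π.symm h') x) = x := by
    intro x
    rw [← A.s_comp]
    refine Eq.trans ?_ (A.s_one x)
    congr 1
    apply Subtype.ext
    funext k
    simp [FinTrans.comp, FinTrans.one, FinTrans.ofPerm]
  -- Evaluating at the `s_π⁻¹`-images makes the outer `s_π` restore the arbitrary valuation `f`.
  have := congrArg (A.s (.ofPerm π h)) (he fun n => A.s (.ofPerm π.symm h') (f n))
  simp only [A.s_eval_of_perm, hinv] at this
  exact this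

theorem QPEA.Models.rename {α : Type u} {A : QPEA.{u, w} α} {e : Equation α}
    (he : A.Models e) (ρ : Equiv.Perm α) : A.Models (e.rename ρ) := by
  obtain ⟨π, hπ, h⟩ := exists_finite_perm_extending e.finite_indices ρ ρ.injective.injOn
  have : e.rename ρ = e.rename π := by
    rw [Equation.rename, Equation.rename,
      Term.rename_congr e.lhs fun i hi => (h i (Or.inl hi)).symm,
      Term.rename_congr e.rhs fun i hi => (h i (Or.inr hi)).symm]
  rw [this]
  exact he.rename_of_finite π hπ

theorem QPEA.isSymmetric {α : Type u} (A : QPEA.{u, w} α) : A.IsSymmetric := by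
  refine fun ρ e => ⟨fun h => h.rename ρ, fun h => ?_⟩
  have h' := h.rename ρ.symm
  rwa [Equation.rename, Equation.rename, Term.rename_symm_rename, Term.rename_symm_rename] at h'

/-! ### The upper bound -/

theorem countable_setOf_finset_subset {α : Type u} {C : Set α} (hC : C.Countable) :
    {Γ : Finset α | (Γ : Set α) ⊆ C}.Countable := by
  refine ((Set.countable_ofPred_finite_subset hC).preimage Finset.coe_injective).mono ?_
  exact fun Γ h => ⟨Γ.finite_toSet, h⟩

theorem FinTrans.countable_setOf_indices_subset {α : Type u} {C : Set α} (hC : C.Countable) :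
    {τ : FinTrans α | τ.indices ⊆ C}.Countable := by
  -- The graph over the moved points is a finite set that determines `τ`.
  let g : FinTrans α → Set (α × α) := fun τ => (fun i => (i, τ i)) '' {i | τ i ≠ i}
  have hg : Function.Injective g := by
    have key : ∀ σ τ : FinTrans α, g σ = g τ → ∀ i, σ i ≠ i → σ i = τ i := by
      intro σ τ h i hi
      have hm : (i, σ i) ∈ g τ := h ▸ ⟨i, hi, rfl⟩
      obtain ⟨j, -, hj⟩ := hm
      obtain ⟨rfl, h2⟩ := Prod.mk.inj hj
      exact h2.symm
    intro σ τ h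
    apply Subtype.ext
    funext i
    by_cases hσ : σ i = i
    · by_cases hτ : τ i = i
      · exact hσ.trans hτ.symm
      · exact (key τ σ h.symm i hτ).symm
    · exact key σ τ h i hσ
  refine ((Set.countable_ofPred_finite_subset (hC.prod hC)).preimage hg).mono ?_
  intro τ hτ
  refine ⟨τ.2.image _, ?_⟩
  rintro _ ⟨i, hi, rfl⟩
  exact ⟨hτ (Or.inl hi), hτ (Or.inr ⟨i, hi, rfl⟩)⟩

/-- The nesting depth of a term. -/
def Term.depth {α : Type u} : Term α → ℕ
  | var _ => 0
  | sup t r => max t.depth r.depth + 1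
  | compl t => t.depth + 1
  | cyl _ t => t.depth + 1
  | subst _ t => t.depth + 1
  | diag _ _ => 0

theorem Term.countable_setOf_indices_subset {α : Type u} {C : Set α} (hC : C.Countable) :
    {t : Term α | t.indices ⊆ C}.Countable := by
  -- Stratified by depth, each layer is covered by countably many applications of the constructors
  -- to the previous one.
  have key : ∀ n, {t : Term α | t.indices ⊆ C ∧ t.depth < n}.Countable := by
    intro n
    induction n with
    | zero => simp
    | succ n ih =>
      set T := {t : Term α | t.indices ⊆ C ∧ t.depth < n}
      have hcount := (((((Set.countable_range (var (α := α))).union (ih.image2 ih sup)).union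
        (ih.image compl)).union ((countable_setOf_finset_subset hC).image2 ih cyl)).union
        ((FinTrans.countable_setOf_indices_subset hC).image2 ih subst)).union
        (hC.image2 hC diag)
      refine hcount.mono ?_
      rintro t ⟨ht, hd⟩
      cases t with
      | var k => exact Or.inl (Or.inl (Or.inl (Or.inl (Or.inl ⟨k, rfl⟩))))
      | sup t r =>
        have hd' : max t.depth r.depth < n := Nat.lt_of_succ_lt_succ hd
        exact Or.inl (Or.inl (Or.inl (Or.inl (Or.inr
          ⟨t, ⟨Set.subset_union_left.trans ht, (le_max_left _ _).trans_lt hd'⟩,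
            r, ⟨Set.subset_union_right.trans ht, (le_max_right _ _).trans_lt hd'⟩, rfl⟩))))
      | compl t =>
        exact Or.inl (Or.inl (Or.inl (Or.inr ⟨t, ⟨ht, Nat.lt_of_succ_lt_succ hd⟩, rfl⟩)))
      | cyl Γ t =>
        exact Or.inl (Or.inl (Or.inr ⟨Γ, Set.subset_union_left.trans ht,
          t, ⟨Set.subset_union_right.trans ht, Nat.lt_of_succ_lt_succ hd⟩, rfl⟩))
      | subst τ t =>
        exact Or.inl (Or.inr ⟨τ, Set.subset_union_left.trans ht,
          t, ⟨Set.subset_union_right.trans ht, Nat.lt_of_succ_lt_succ hd⟩, rfl⟩)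
      | diag i j =>
        exact Or.inr ⟨i, ht (Set.mem_insert i {j}), j, ht (Set.mem_insert_of_mem i rfl), rfl⟩
  refine (Set.countable_iUnion key).mono ?_
  intro t ht
  exact Set.mem_iUnion.2 ⟨t.depth + 1, ht, Nat.lt_succ_self _⟩

theorem Equation.countable_setOf_indices_subset {α : Type u} {C : Set α} (hC : C.Countable) :
    {e : Equation α | e.indices ⊆ C}.Countable := by
  have h := Term.countable_setOf_indices_subset hC
  refine (h.image2 h Equation.mk).mono ?_
  rintro ⟨l, r⟩ he
  exact ⟨l, Set.subset_union_left.trans he, r, Set.subset_union_right.trans he, rfl⟩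

theorem Equation.exists_rename_indices_subset {α : Type u} {C : Set α} (hC : C.Infinite)
    (e : Equation α) : ∃ ρ : Equiv.Perm α, (e.rename ρ).indices ⊆ C := by
  have : Nonempty α := hC.nonempty.to_type
  obtain ⟨f, hfC, hf⟩ := e.finite_indices.exists_injOn_of_encard_le (t := C)
    (by rw [hC.encard_eq]; exact le_top)
  obtain ⟨π, -, h⟩ := exists_finite_perm_extending e.finite_indices f hf
  refine ⟨π, (e.indices_rename_subset π).trans ?_⟩
  rintro _ ⟨i, hi, rfl⟩
  rw [h i hi]
  exact hfC hi

/-- A subvariety is determined by the equations, over any fixed infinite set of indices, that are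
valid in it. -/
theorem IsSubvariety.eq_models {α : Type u} {C : Set α} (hC : C.Infinite)
    {V : Set (QPEA.{u, w} α)} (hV : IsSubvariety V) :
    V = {A | ∀ e : Equation α, e.indices ⊆ C → (∀ B ∈ V, B.Models e) → A.Models e} := by
  obtain ⟨E, rfl⟩ := hV
  refine Set.Subset.antisymm (fun A hA e _ h => h A hA) ?_
  intro A hA e he
  obtain ⟨ρ, hρ⟩ := e.exists_rename_indices_subset hC
  exact (A.isSymmetric ρ e).2 (hA _ hρ fun B hB => (hB e he).rename ρ)

theorem mk_subvarieties_le (α : Type u) [Infinite α] :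
    Cardinal.mk {V : Set (QPEA.{u, w} α) // IsSubvariety V} ≤ Cardinal.continuum := by
  let C : Set α := Set.range (Infinite.natEmbedding α)
  have hC : C.Infinite := Set.infinite_range_of_injective (Infinite.natEmbedding α).injective
  let K : Set (Equation α) := {e | e.indices ⊆ C}
  have : Countable K := (Equation.countable_setOf_indices_subset (Set.countable_range _)).to_subtype
  let F : {V : Set (QPEA.{u, w} α) // IsSubvariety V} → Set K :=
    fun V => {e | ∀ B ∈ V.1, B.Models e.1}
  have hF : Function.Injective F := by
    intro V W h
    apply Subtype.ext
    rw [V.2.eq_models hC, W.2.eq_models hC]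
    ext A
    refine forall_congr' fun e => forall_congr' fun he => imp_congr_left ?_
    exact Set.ext_iff.1 h ⟨e, he⟩
  -- The two types live in different universes, so both are lifted before comparison.
  have h1 := Cardinal.mk_le_of_injective
    (ULift.up_injective.comp (hF.comp ULift.down_injective) :
      Function.Injective fun V : ULift.{u} _ => (ULift.up.{max u (w + 1)} (F V.down)))
  rw [Cardinal.mk_uLift, Cardinal.mk_uLift, Cardinal.mk_set] at h1
  have h2 : (2 : Cardinal.{u}) ^ Cardinal.mk K ≤ Cardinal.continuum := by
    rw [← Cardinal.two_power_aleph0]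
    exact Cardinal.power_le_power_left two_ne_zero Cardinal.mk_le_aleph0
  have h3 := h1.trans (Cardinal.lift_le.2 h2)
  rw [Cardinal.lift_continuum] at h3
  exact Cardinal.lift_le_continuum.1 h3

/-! ### The lower bound -/

open Classical in
/-- The full quasi-polyadic equality set algebra with base `U`. -/
def setAlgebra (α : Type u) (U : Type v) : QPEA.{u, max u v} α where
  carrier := Set (α → U)
  c Γ X := {f | ∃ g ∈ X, ∀ i, i ∉ Γ → g i = f i}
  s τ X := {f | f ∘ τ ∈ X}
  d i j := {f | f i = f j}
  c_bot Γ := by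
    ext f
    simp
  le_c Γ X f hf := ⟨f, hf, fun _ _ => rfl⟩
  c_inf_c Γ X Y := by
    ext f
    constructor
    · rintro ⟨g, ⟨hX, h, hY, hh⟩, hg⟩
      exact ⟨⟨g, hX, hg⟩, h, hY, fun i hi => (hh i hi).trans (hg i hi)⟩
    · rintro ⟨⟨g, hX, hg⟩, h, hY, hh⟩
      exact ⟨g, ⟨hX, h, hY, fun i hi => (hh i hi).trans (hg i hi).symm⟩, hg⟩
  c_empty X := by
    ext f
    constructor
    · rintro ⟨g, hX, hg⟩
      rwa [← funext fun i => hg i (Finset.notMem_empty i)]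
    · exact fun hf => ⟨f, hf, fun _ _ => rfl⟩
  c_c Γ Δ X := by
    ext f
    constructor
    · rintro ⟨g, ⟨h, hX, hh⟩, hg⟩
      refine ⟨h, hX, fun i hi => ?_⟩
      rw [Finset.mem_union, not_or] at hi
      exact (hh i hi.2).trans (hg i hi.1)
    · rintro ⟨h, hX, hh⟩
      -- The intermediate point changes `f` to `h` on `Γ` first, leaving `Δ \ Γ` for the inner
      -- cylindrification.
      refine ⟨fun i => if i ∈ Γ then h i else f i, ⟨h, hX, fun i hi => ?_⟩,
        fun i hi => if_neg hi⟩
      by_cases hΓ : i ∈ Γ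
      · simp [hΓ]
      · simpa [hΓ] using hh i (by simp [hΓ, hi])
  s_one X := rfl
  s_comp σ τ X := rfl
  s_sup τ X Y := rfl
  s_compl τ X := rfl
  s_c_congr Γ σ τ X h := by
    ext f
    refine exists_congr fun g => and_congr_right fun _ => forall_congr' fun i =>
      forall_congr' fun hi => ?_
    simp only [Function.comp_apply, h i hi]
  c_s Γ Δ τ X hΔ hτ := by
    have hmem : ∀ i, τ i ∈ Γ ↔ i ∈ Δ := fun i => Set.ext_iff.1 hΔ i
    ext f
    constructor
    · rintro ⟨g, hX, hg⟩
      exact ⟨g ∘ τ, hX, fun i hi => hg _ (mt (hmem i).1 hi)⟩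
    · rintro ⟨h, hX, hh⟩
      -- `h` is transported along the inverse of `τ` on `τ[Δ]`. Outside `Δ`, `τ` avoids `τ[Δ]`,
      -- because `Δ` is the full preimage of `Γ`.
      let g : α → U := fun a => if H : ∃ i ∈ Δ, τ i = a then h H.choose else f a
      have hg : g ∘ τ = h := by
        funext i
        by_cases hi : i ∈ Δ
        · have H : ∃ j ∈ Δ, τ j = τ i := ⟨i, hi, rfl⟩
          have : H.choose = i := hτ H.choose_spec.1 hi H.choose_spec.2
          change dite _ _ _ = _
          rw [dif_pos H, this]
        · have H : ¬ ∃ j ∈ Δ, τ j = τ i := by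
            rintro ⟨j, hj, hji⟩
            exact hi ((hmem i).1 (hji ▸ (hmem j).2 hj))
          change dite _ _ _ = _
          rw [dif_neg H]
          exact (hh i hi).symm
      refine ⟨g, ?_, fun a ha => dif_neg ?_⟩
      · change g ∘ τ ∈ X
        rwa [hg]
      · rintro ⟨i, hi, rfl⟩
        exact ha ((hmem i).2 hi)
  d_self i := by
    ext f
    simp
  inf_d_le i j X := by
    rintro f ⟨hX, hf⟩
    change f ∘ Function.update id i j ∈ X
    rwa [Function.comp_update, Function.comp_id, ← (show f i = f j from hf),
      Function.update_eq_self]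
  s_d τ i j := rfl

/-- A term denoting the join of `-d_aa` and the `d_ij` with `(i, j)` in the list. -/
def someDiag {α : Type u} (a : α) : List (α × α) → Term α
  | [] => .compl (.diag a a)
  | p :: l => .sup (.diag p.1 p.2) (someDiag a l)

theorem mem_eval_someDiag {α : Type u} {U : Type v} (a : α) (l : List (α × α))
    (x : ℕ → (setAlgebra α U).carrier) (f : α → U) :
    f ∈ (show Set (α → U) from (someDiag a l).eval (setAlgebra α U) x) ↔
      ∃ p ∈ l, f p.1 = f p.2 := by
  induction l with
  | nil =>
    simp only [List.not_mem_nil, false_and, exists_false, iff_false]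
    exact fun h => h rfl
  | cons p l ih =>
    rw [List.exists_mem_cons_iff, ← ih]
    rfl

/-- A term expressing that the base has at least `n` elements. -/
noncomputable def atLeast {α : Type u} (ι : ℕ ↪ α) (n : ℕ) : Term α :=
  .cyl ((Finset.range n).map ι) (.compl (someDiag (ι 0)
    ((Finset.range n).offDiag.toList.map fun p => (ι p.1, ι p.2))))

/-- Cylindrifying over the first `n` indices frees those coordinates, so membership no longer
depends on `f`. -/
theorem mem_eval_atLeast {α : Type u} {U : Type v} (ι : ℕ ↪ α) (n : ℕ)
    (x : ℕ → (setAlgebra α U).carrier) (f : α → U) :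
    f ∈ (show Set (α → U) from (atLeast ι n).eval (setAlgebra α U) x) ↔
      ∃ h : Fin n → U, Function.Injective h := by
  classical
  have hdist : ∀ g : α → U, g ∈ (show Set (α → U) from (Term.compl (someDiag (ι 0)
      ((Finset.range n).offDiag.toList.map fun p => (ι p.1, ι p.2)))).eval (setAlgebra α U) x) ↔
      ∀ i < n, ∀ j < n, i ≠ j → g (ι i) ≠ g (ι j) := by
    intro g
    refine (not_congr (mem_eval_someDiag _ _ x g)).trans ?_
    simp only [List.mem_map, Finset.mem_toList, Finset.mem_offDiag, Finset.mem_range,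
      Prod.exists]
    constructor
    · intro h i hi j hj hij hg
      exact h ⟨_, _, ⟨i, j, ⟨hi, hj, hij⟩, rfl⟩, hg⟩
    · rintro h ⟨_, _, ⟨i, j, ⟨hi, hj, hij⟩, hp⟩, hg⟩
      obtain ⟨rfl, rfl⟩ := Prod.mk.inj hp
      exact h i hi j hj hij hg
  constructor
  · rintro ⟨g, hg, -⟩
    rw [hdist] at hg
    refine ⟨fun i => g (ι i), fun i j hij => ?_⟩
    by_contra hne
    exact hg i i.2 j j.2 (fun h => hne (Fin.ext h)) hij
  · rintro ⟨h, hh⟩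
    let e : Fin n → α := fun i => ι i
    have he : Function.Injective e := ι.injective.comp Fin.val_injective
    have hval : ∀ i (hi : i < n), Function.extend e h f (ι i) = h ⟨i, hi⟩ :=
      fun i hi => he.extend_apply h f ⟨i, hi⟩
    refine ⟨Function.extend e h f, (hdist _).2 ?_, fun a ha => ?_⟩
    · intro i hi j hj hij heq
      rw [hval i hi, hval j hj] at heq
      exact hij (Fin.mk.inj (hh heq))
    · refine Function.extend_apply' _ _ _ ?_
      rintro ⟨i, rfl⟩
      exact ha (Finset.mem_map_of_mem ι (Finset.mem_range.2 i.2))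

/-- The equation saying that a base with at least `n` elements has more than `n`. -/
noncomputable def sizeNe {α : Type u} (ι : ℕ ↪ α) (n : ℕ) : Equation α :=
  ⟨.sup (atLeast ι (n + 1)) (atLeast ι n), atLeast ι (n + 1)⟩

theorem setAlgebra_models_sizeNe {α : Type u} (ι : ℕ ↪ α) (U : Type v) [Fintype U] [Nonempty U]
    (n : ℕ) : (setAlgebra α U).Models (sizeNe ι n) ↔ Fintype.card U ≠ n := by
  have hmem : ∀ k x (f : α → U),
      f ∈ (show Set (α → U) from (atLeast ι k).eval (setAlgebra α U) x) ↔ k ≤ Fintype.card U := by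
    intro k x f
    rw [mem_eval_atLeast]
    constructor
    · rintro ⟨h, hh⟩
      simpa using Fintype.card_le_of_injective h hh
    · intro hk
      obtain ⟨e⟩ := Function.Embedding.nonempty_of_card_le (α := Fin k) (β := U) (by simpa using hk)
      exact ⟨e, e.injective⟩
  constructor
  · rintro h rfl
    -- Nonemptiness supplies a point to test at; over an empty base the algebra is trivial and
    -- satisfies every equation.
    let f : α → U := fun _ => Classical.arbitrary U
    have h1 := (Set.ext_iff.1 (h fun _ => (∅ : Set (α → U))) f).1
      (Or.inr ((hmem _ _ f).2 le_rfl))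
    exact absurd ((hmem _ _ f).1 h1) (Nat.not_succ_le_self _)
  · intro hn x
    refine Set.ext fun f => ⟨?_, Or.inl⟩
    rintro (h | h)
    · exact h
    · exact (hmem _ x f).2 (Nat.succ_le_of_lt (lt_of_le_of_ne ((hmem _ x f).1 h) hn.symm))

/-- `X` is recovered from its subvariety by testing set algebras with bases of `n + 1` elements; the
shift avoids the empty base. -/
theorem continuum_le_mk_subvarieties (α : Type u) [Infinite α] :
    Cardinal.continuum ≤ Cardinal.mk {V : Set (QPEA.{u, max u v} α) // IsSubvariety V} := by
  let ι := Infinite.natEmbedding α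
  let F : Set ℕ → {V : Set (QPEA.{u, max u v} α) // IsSubvariety V} := fun X =>
    ⟨{A | ∀ e ∈ (fun n => sizeNe ι (n + 1)) '' X, A.Models e}, _, rfl⟩
  have hmem : ∀ X n, setAlgebra α (ULift.{v} (Fin (n + 1))) ∈ (F X).1 ↔ n ∉ X := by
    intro X n
    simp only [F, Set.mem_ofPred_eq, Set.forall_mem_image, setAlgebra_models_sizeNe,
      Fintype.card_ulift, Fintype.card_fin]
    exact ⟨fun h hn => h hn rfl, fun h m hm hmn => h (Nat.succ_injective hmn ▸ hm)⟩
  have hF : Function.Injective F := by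
    intro X Y h
    ext n
    rw [← not_iff_not, ← hmem, ← hmem, h]
  have h1 := Cardinal.mk_le_of_injective (hF.comp ULift.down_injective)
  rwa [Cardinal.mk_uLift, Cardinal.mk_set, Cardinal.mk_nat, Cardinal.two_power_aleph0,
    Cardinal.lift_continuum] at h1

end QuasiPolyadic

theorem theorem4p5 (α : Type u) [Infinite α] :
    Cardinal.mk {V : Set (QuasiPolyadic.QPEA.{u, max u v} α) // QuasiPolyadic.IsSubvariety V} =
        Cardinal.continuum ∧
      ∀ A : QuasiPolyadic.QPEA.{u, max u v} α, A.IsSymmetric :=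
  ⟨le_antisymm (QuasiPolyadic.mk_subvarieties_le α)
    (QuasiPolyadic.continuum_le_mk_subvarieties.{u, v} α), fun A => A.isSymmetric⟩
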